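/- For $j\in\mathbb Z_+=\{0,1,2,\dots\}$ let $p_j$ be real monic polynomials of degree $k_j\ge 1$, let $\varepsilon_j\in\{1,-1\}$ and $b_j>0$. Assume that the degrees $k_j$ are bounded and that the numbers $b_j$ and the absolute values of all coefficients of all $p_j$ are bounded. Put $n_j=k_0+\dots+k_{j-1}$ ($n_0=0$), and let $e_{j,r}$ ($j\ge 0$, $0\le r<k_j$) denote the standard basis of the complex Hilbert space $\ell^2_{[0,\infty)}$, where $e_{j,r}$ has its single entry $1$ at position $n_j+r$; put $e=e_{0,0}$. For a monic polynomial $q(\lambda)=\lambda^n+q_{n-1}\lambda^{n-1}+\dots+q_0$ (and $q_n=1$), let $C_q$ be the companion matrix with ones on the subdiagonal, last column $(-q_0,\dots,-q_{n-1})^\top$ and zeros elsewhere, and let $E_q$ be the symmetric $n\times n$ matrix with entries $(E_q)_{r,c}=q_{r+c+1}$ for $0\le r,c<n$ (where $q_i=0$ for $i>n$). Let $H$ be the bounded operator on $\ell^2_{[0,\infty)}$ given by the block tridiagonal (generalized Jacobi) matrix with diagonal blocks $C_{p_j}$, whose block in block row $j+1$ and block column $j$ has the single nonzero entry $b_j$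 in its upper right corner, and whose block in block row $j$ and block column $j+1$ has the single nonzero entry $\varepsilon_j\varepsilon_{j+1}b_j$ in its upper right corner. Let $G$ be the bounded operator given by the block diagonal matrix with blocks $\varepsilon_jE_{p_j}^{-1}$, let $[x,y]=(Gx,y)_{\ell^2}$, and let $$m(\lambda)=[(H-\lambda)^{-1}e,e]\qquad(\lambda\in\rho(H))$$ be the Weyl function of $H$, where $\rho(H)$ is the resolvent set of $H$. Let the polynomials $P_j$, $Q_j$ be the solutions of $$\varepsilon_{j-1}\varepsilon_jb_{j-1}u_{j-1}-p_j(\lambda)u_j+b_ju_{j+1}=0\qquad(j\ge 1)$$ with $P_0=1$, $P_1=p_0/b_0$, $Q_0=0$, $Q_1=\varepsilon_0/b_0$. For every $j\ge1$ the rational function $-Q_j/P_j$ is the $[n_j/n_j]$ (diagonal) Padé approximant to $m$ at infinity: $-Q_j(\lambda)/P_j(\lambda)=A(1/\lambda)/B(1/\lambda)$ with polynomials $A,B$ of degree at most $n_j$, $B(0)\ne0$, and $m(\lambda)+Q_j(\lambda)/P_j(\lambda)=O(\lambda^{-(2n_j+1)})$ as $\lambda\to\infty$. Moreover, for every $\lambda\in\rho(H)$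 there is a subsequence of these diagonal Padé approximants which converges to $m(\lambda)$ at the point $\lambda$, and the convergence is geometric along it: there are indices $1\le j_1<j_2<\cdots$ with $P_{j_i}(\lambda)\ne0$ for all $i$, and constants $c>0$ and $r\in(0,1)$, such that $-Q_{j_i}(\lambda)/P_{j_i}(\lambda)\to m(\lambda)$ as $i\to\infty$ and $$\left|m(\lambda)+\frac{Q_{j_i}(\lambda)}{P_{j_i}(\lambda)}\right|\le c\,r^{\,j_i}\qquad\text{for all } i.$$ -/

import Mathlib

open scoped BigOperators
open Polynomial

noncomputable section

/-! ### Bounded operators on `ℓ²` given by band-type matrices -/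

/-- The complex Hilbert space `ℓ²` over the index set `ι`. -/
abbrev EllTwo (ι : Type) : Type := lp (fun _ : ι => ℂ) 2

/-- A real matrix whose entries are uniformly bounded and whose rows and columns contain a
uniformly bounded number of nonzero entries. -/
def IsBandBounded {ι : Type} (M : Matrix ι ι ℝ) : Prop :=
  ∃ (c : ℝ) (d : ℕ), (∀ i j, |M i j| ≤ c) ∧
    (∀ i, {j | M i j ≠ 0}.encard ≤ d) ∧ (∀ j, {i | M i j ≠ 0}.encard ≤ d)

/-- The matrix-vector product `(M x)_i = ∑_j M_{ij} x_j`. -/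
def matVec {ι : Type} (M : Matrix ι ι ℝ) (x : ι → ℂ) (i : ι) : ℂ := ∑' j, (M i j : ℂ) * x j

lemma matVec_eq_sum {ι : Type} (M : Matrix ι ι ℝ) {i : ι} {S : Finset ι}
    (hS : ∀ j, M i j ≠ 0 → j ∈ S) (x : ι → ℂ) :
    matVec M x i = ∑ j ∈ S, (M i j : ℂ) * x j := by
  refine tsum_eq_sum fun j hj => ?_
  have : M i j = 0 := by
    by_contra h
    exact hj (hS j h)
  simp [this]

lemma IsBandBounded.sum_le {ι : Type} {M : Matrix ι ι ℝ} (h : IsBandBounded M) :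
    ∃ K : ℝ, 0 ≤ K ∧ ∀ (x : EllTwo ι) (F : Finset ι),
      ∑ i ∈ F, ‖matVec M x i‖ ^ 2 ≤ K ^ 2 * ‖x‖ ^ 2 := by
  classical
  obtain ⟨c, d, hc, hrow, hcol⟩ := h
  have hfin : ∀ i, {j | M i j ≠ 0}.Finite := fun i =>
    Set.finite_of_encard_le_coe (hrow i)
  refine ⟨d * |c|, by positivity, fun x F => ?_⟩
  set S : ι → Finset ι := fun i => (hfin i).toFinset with hS
  have memS : ∀ i j, j ∈ S i ↔ M i j ≠ 0 := fun i j => by simp [hS]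
  have cardS : ∀ i, ((S i).card : ℝ) ≤ d := fun i => by
    have := hrow i
    rw [(hfin i).encard_eq_coe_toFinset_card] at this
    exact_mod_cast this
  have h1 : ∀ i, ‖matVec M x i‖ ^ 2 ≤ d * ∑ j ∈ S i, |c| ^ 2 * ‖x j‖ ^ 2 := fun i => by
    rw [matVec_eq_sum M (S := S i) (fun j hj => (memS i j).2 hj)]
    calc ‖∑ j ∈ S i, (M i j : ℂ) * x j‖ ^ 2
        ≤ (∑ j ∈ S i, |c| * ‖x j‖) ^ 2 := by
          gcongr
          refine (norm_sum_le _ _).trans (Finset.sum_le_sum fun j _ => ?_)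
          rw [norm_mul, Complex.norm_real, Real.norm_eq_abs]
          exact mul_le_mul_of_nonneg_right ((hc i j).trans (le_abs_self c)) (norm_nonneg _)
      _ ≤ (S i).card * ∑ j ∈ S i, (|c| * ‖x j‖) ^ 2 := sq_sum_le_card_mul_sum_sq
      _ ≤ d * ∑ j ∈ S i, |c| ^ 2 * ‖x j‖ ^ 2 := by
          simp_rw [mul_pow]
          exact mul_le_mul_of_nonneg_right (cardS i)
            (Finset.sum_nonneg fun j _ => by positivity)
  set U : Finset ι := F.biUnion S with hU
  have h2 : ∑ i ∈ F, ∑ j ∈ S i, |c| ^ 2 * ‖x j‖ ^ 2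
      ≤ ∑ j ∈ U, d * (|c| ^ 2 * ‖x j‖ ^ 2) := by
    have : ∀ i ∈ F, ∑ j ∈ S i, |c| ^ 2 * ‖x j‖ ^ 2
        = ∑ j ∈ U, if j ∈ S i then |c| ^ 2 * ‖x j‖ ^ 2 else 0 := fun i hi => by
      rw [← Finset.sum_filter]
      congr 1
      ext j
      simp only [Finset.mem_filter, hU, Finset.mem_biUnion]
      exact ⟨fun h => ⟨⟨i, hi, h⟩, h⟩, fun h => h.2⟩
    rw [Finset.sum_congr rfl this, Finset.sum_comm]
    refine Finset.sum_le_sum fun j _ => ?_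
    rw [← Finset.sum_filter, Finset.sum_const, nsmul_eq_mul]
    gcongr
    have hle : ((F.filter fun i => j ∈ S i : Finset ι) : Set ι).encard ≤ d :=
      (Set.encard_le_encard (fun i hi => by
        simp only [Finset.coe_filter, Set.mem_ofPred_eq] at hi
        exact (memS i j).1 hi.2)).trans (hcol j)
    rw [Set.encard_coe_eq_coe_finsetCard] at hle
    exact_mod_cast hle
  have h3 : ∑ j ∈ U, ‖x j‖ ^ 2 ≤ ‖x‖ ^ 2 := by
    have := lp.sum_rpow_le_norm_rpow (p := 2) (by norm_num) x U
    simpa using this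
  calc ∑ i ∈ F, ‖matVec M x i‖ ^ 2
      ≤ ∑ i ∈ F, d * ∑ j ∈ S i, |c| ^ 2 * ‖x j‖ ^ 2 := Finset.sum_le_sum fun i _ => h1 i
    _ = d * ∑ i ∈ F, ∑ j ∈ S i, |c| ^ 2 * ‖x j‖ ^ 2 := by rw [Finset.mul_sum]
    _ ≤ d * ∑ j ∈ U, d * (|c| ^ 2 * ‖x j‖ ^ 2) := by gcongr
    _ = (d * |c|) ^ 2 * ∑ j ∈ U, ‖x j‖ ^ 2 := by
        rw [Finset.mul_sum, Finset.mul_sum]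
        exact Finset.sum_congr rfl fun j _ => by ring
    _ ≤ (d * |c|) ^ 2 * ‖x‖ ^ 2 := by gcongr

lemma IsBandBounded.memℓp {ι : Type} {M : Matrix ι ι ℝ} (h : IsBandBounded M) (x : EllTwo ι) :
    Memℓp (matVec M x) 2 := by
  obtain ⟨K, _, hK⟩ := h.sum_le
  refine memℓp_gen' (C := K ^ 2 * ‖x‖ ^ 2) fun s => ?_
  simpa using hK x s

lemma IsBandBounded.matVec_add {ι : Type} {M : Matrix ι ι ℝ} (h : IsBandBounded M)
    (x y : ι → ℂ) : matVec M (x + y) = matVec M x + matVec M y := by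
  obtain ⟨c, d, hc, hrow, hcol⟩ := h
  funext i
  have hS : ∀ j, M i j ≠ 0 → j ∈ (Set.finite_of_encard_le_coe (hrow i)).toFinset := by simp
  rw [Pi.add_apply, matVec_eq_sum M hS, matVec_eq_sum M hS, matVec_eq_sum M hS,
    ← Finset.sum_add_distrib]
  exact Finset.sum_congr rfl fun j _ => by simp [mul_add]

lemma matVec_smul {ι : Type} (M : Matrix ι ι ℝ) (a : ℂ) (x : ι → ℂ) :
    matVec M (a • x) = a • matVec M x := by
  funext i
  simp only [matVec, Pi.smul_apply, smul_eq_mul, ← tsum_mul_left]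
  exact tsum_congr fun j => by ring

/-- The bounded operator `x ↦ M x` on `ℓ²` defined by a band-bounded matrix. -/
def matrixOp {ι : Type} (M : Matrix ι ι ℝ) (h : IsBandBounded M) : EllTwo ι →L[ℂ] EllTwo ι :=
  LinearMap.mkContinuousOfExistsBound
    { toFun := fun x => ⟨matVec M x, h.memℓp x⟩
      map_add' := fun x y => by
        ext i
        exact congrFun (h.matVec_add x y) i
      map_smul' := fun a x => by
        ext i
        exact congrFun (matVec_smul M a x) i }
    (by
      obtain ⟨K, hK0, hK⟩ := h.sum_le
      refine ⟨K, fun x => ?_⟩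
      refine lp.norm_le_of_forall_sum_le (p := 2) (by norm_num) (by positivity) fun s => ?_
      have := hK x s
      rw [← mul_pow] at this
      simpa using this)

@[simp] lemma matrixOp_apply {ι : Type} (M : Matrix ι ι ℝ) (h : IsBandBounded M)
    (x : EllTwo ι) (i : ι) : matrixOp M h x i = ∑' j, (M i j : ℂ) * x j := rfl

/-! ### Companion matrices and symmetrizators -/

/-- The companion matrix `C_q` of a monic polynomial `q`: ones on the subdiagonal and
`-q_0, …, -q_{n-1}` in the last column. -/
def companionMatrix (q : ℝ[X]) : Matrix (Fin q.natDegree) (Fin q.natDegree) ℝ :=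
  Matrix.of fun r c =>
    if (c : ℕ) + 1 = q.natDegree then -q.coeff r else if (r : ℕ) = c + 1 then 1 else 0

/-- The symmetrizator `E_q`: the entry in row `r` and column `c` (counted from `0`) is
`q_{r+c+1}`, so the first row is `q_1, …, q_n` and everything below the antidiagonal is `0`. -/
def symmetrizator (q : ℝ[X]) : Matrix (Fin q.natDegree) (Fin q.natDegree) ℝ :=
  Matrix.of fun r c => q.coeff ((r : ℕ) + c + 1)

/-! ### Generalized Jacobi matrices -/

/-- The data of a generalized Jacobi matrix: nonconstant real monic polynomials `p_j`, signs `ε_j`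
and positive numbers `b_j`, for `j = 0, 1, 2, …`. -/
structure GenJacobi where
  /-- the polynomials `p_j` -/
  p : ℕ → ℝ[X]
  /-- the signs `ε_j` -/
  ε : ℕ → ℝ
  /-- the numbers `b_j` -/
  b : ℕ → ℝ
  monic : ∀ j, (p j).Monic
  deg_pos : ∀ j, 0 < (p j).natDegree
  sign : ∀ j, ε j = 1 ∨ ε j = -1
  b_pos : ∀ j, 0 < b j

namespace GenJacobi

variable (D : GenJacobi)

/-- The degree `k_j` of `p_j`. -/
def k (j : ℕ) : ℕ := (D.p j).natDegree

/-- The index `n_j = k_0 + ⋯ + k_{j-1}`. -/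
def n (j : ℕ) : ℕ := ∑ i ∈ Finset.range j, D.k i

/-- The index set of the standard basis `e_{j,r}`, `j = 0, 1, …`, `r = 0, …, k_j - 1`. Listing it
lexicographically identifies `(j, r)` with the number `n_j + r`. -/
abbrev Idx : Type := Σ j : ℕ, Fin (D.p j).natDegree

/-- The boundedness assumptions: the degrees of the `p_j` are bounded, and so are the `b_j`
together with the coefficients of the `p_j`. -/
structure Bounded : Prop where
  degrees : ∃ N : ℕ, ∀ j, (D.p j).natDegree ≤ N
  coeffs : ∃ K : ℝ, ∀ j, D.b j ≤ K ∧ ∀ r < (D.p j).natDegree, |(D.p j).coeff r| ≤ K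

/-- The generalized Jacobi matrix. It is block tridiagonal: the diagonal blocks are the companion
matrices of the `p_j`; the block in block row `j + 1` and block column `j` has the single nonzero
entry `b_j` in its upper right corner; the block in block row `j` and block column `j + 1` has the
single nonzero entry `ε_j ε_{j+1} b_j` in its upper right corner. -/
def Hmat : Matrix D.Idx D.Idx ℝ :=
  Matrix.blockDiagonal' (fun j => companionMatrix (D.p j)) +
  Matrix.of fun x y =>
    if (x.2 : ℕ) = 0 ∧ (y.2 : ℕ) + 1 = (D.p y.1).natDegree then
      if x.1 = y.1 + 1 then D.b y.1
      else if y.1 = x.1 + 1 then D.ε x.1 * D.ε y.1 * D.b x.1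
      else 0
    else 0

/-- The Gram matrix `G = diag(G_0, G_1, …)` with `G_j = ε_j E_{p_j}⁻¹`. -/
def Gmat : Matrix D.Idx D.Idx ℝ :=
  Matrix.blockDiagonal' fun j => D.ε j • (symmetrizator (D.p j))⁻¹

end GenJacobi

/-! Helper facts: both matrices define bounded operators under the boundedness assumptions. -/

lemma abs_det_symmetrizator {q : ℝ[X]} (hq : q.Monic) : |(symmetrizator q).det| = 1 := by
  have h1 : ((symmetrizator q).submatrix (Fin.revPerm) id).det = 1 := by
    rw [Matrix.det_of_isLowerTriangular]
    · refine Finset.prod_eq_one fun i _ => ?_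
      have : q.natDegree - (↑i + 1) + ↑i + 1 = q.natDegree := by have := i.2; omega
      simp only [symmetrizator, Matrix.submatrix_apply, Matrix.of_apply, Fin.revPerm_apply,
        Fin.val_rev, id, this]
      exact hq.coeff_natDegree
    · intro i j hij
      simp only [symmetrizator, Matrix.submatrix_apply, Matrix.of_apply, Fin.revPerm_apply,
        Fin.val_rev, id]
      refine Polynomial.coeff_eq_zero_of_natDegree_lt ?_
      have h : (i : ℕ) < j := by simpa using hij
      have := i.2
      omega
  rw [Matrix.det_permute] at h1
  have h2 := congrArg abs h1
  rw [abs_mul, abs_one] at h2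
  rcases Int.units_eq_one_or (Equiv.Perm.sign (Fin.revPerm : Equiv.Perm (Fin q.natDegree)))
    with h | h <;> simpa [h] using h2

lemma abs_inv_symmetrizator_le {q : ℝ[X]} (hq : q.Monic) {K : ℝ} {N : ℕ} (hK : 1 ≤ K)
    (hN : q.natDegree ≤ N) (hc : ∀ r < q.natDegree, |q.coeff r| ≤ K)
    (i j : Fin q.natDegree) : |(symmetrizator q)⁻¹ i j| ≤ N.factorial * K ^ N := by
  have hent : ∀ r c, |symmetrizator q r c| ≤ K := fun r c => by
    simp only [symmetrizator, Matrix.of_apply]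
    rcases lt_trichotomy ((r : ℕ) + c + 1) q.natDegree with h | h | h
    · exact hc _ h
    · rw [h, hq.coeff_natDegree]
      simpa using hK
    · rw [Polynomial.coeff_eq_zero_of_natDegree_lt h]
      simp only [abs_zero]
      linarith
  rw [Matrix.inv_def, Matrix.smul_apply, smul_eq_mul, abs_mul, Ring.inverse_eq_inv', abs_inv,
    abs_det_symmetrizator hq, inv_one, one_mul, Matrix.adjugate_apply]
  have := Matrix.det_le (abv := AbsoluteValue.abs)
    (A := (symmetrizator q).updateRow j (Pi.single i 1)) (x := K) (fun r c => by
      simp only [Matrix.updateRow_apply, AbsoluteValue.abs_apply]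
      split_ifs
      · by_cases h : c = i
        · subst h
          simpa using hK
        · simp only [Pi.single_eq_of_ne h, abs_zero]
          linarith
      · exact hent r c)
  simp only [AbsoluteValue.abs_apply, Fintype.card_fin, nsmul_eq_mul] at this
  refine this.trans ?_
  gcongr

namespace GenJacobi

variable {D : GenJacobi}

lemma encard_le_of_near {N : ℕ} (hN : ∀ j, (D.p j).natDegree ≤ N) (i : D.Idx) (T : Set D.Idx)
    (hT : ∀ y ∈ T, i.1 ≤ y.1 + 1 ∧ y.1 ≤ i.1 + 1) : T.encard ≤ (3 * N : ℕ) := by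
  classical
  have hsub : T ⊆ (((Finset.Icc (i.1 - 1) (i.1 + 1)).sigma
      fun j => (Finset.univ : Finset (Fin (D.p j).natDegree)) : Finset D.Idx) : Set D.Idx) := by
    intro y hy
    have := hT y hy
    simp only [Finset.coe_sigma, Set.mem_sigma_iff, Finset.mem_coe, Finset.mem_Icc,
      Finset.mem_univ, and_true]
    omega
  refine (Set.encard_le_encard hsub).trans ?_
  rw [Set.encard_coe_eq_coe_finsetCard, Finset.card_sigma]
  refine Nat.cast_le.2 ?_
  calc ∑ a ∈ Finset.Icc (i.1 - 1) (i.1 + 1), (Finset.univ : Finset (Fin (D.p a).natDegree)).card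
      ≤ ∑ a ∈ Finset.Icc (i.1 - 1) (i.1 + 1), N :=
        Finset.sum_le_sum fun a _ => by simpa using hN a
    _ ≤ 3 * N := by
        rw [Finset.sum_const, smul_eq_mul, Nat.card_Icc]
        exact Nat.mul_le_mul_right _ (by omega)

lemma isBandBounded_of_near (h : D.Bounded) {M : Matrix D.Idx D.Idx ℝ} {c : ℝ}
    (hc : ∀ x y, |M x y| ≤ c) (hM : ∀ x y, M x y ≠ 0 → x.1 ≤ y.1 + 1 ∧ y.1 ≤ x.1 + 1) :
    IsBandBounded M := by
  obtain ⟨N, hN⟩ := h.degrees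
  exact ⟨c, 3 * N, hc, fun i => encard_le_of_near hN i _ fun y hy => hM i y hy,
    fun j => encard_le_of_near hN j _ fun y hy => (hM y j hy).symm⟩

lemma isBandBounded_Hmat (h : D.Bounded) : IsBandBounded D.Hmat := by
  obtain ⟨K, hK⟩ := h.coeffs
  have hK0 : 0 < K := (D.b_pos 0).trans_le (hK 0).1
  have hb : ∀ j, |D.b j| ≤ K := fun j => by rw [abs_of_pos (D.b_pos j)]; exact (hK j).1
  have hε : ∀ j, |D.ε j| = 1 := fun j => by rcases D.sign j with h | h <;> simp [h]
  refine isBandBounded_of_near h (c := (K + 1) + K) (fun x y => ?_) fun x y hxy => ?_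
  · rw [Hmat, Matrix.add_apply]
    refine (abs_add_le _ _).trans (add_le_add ?_ ?_)
    · obtain ⟨i, r⟩ := x
      obtain ⟨j, s⟩ := y
      by_cases hij : i = j
      · subst hij
        rw [Matrix.blockDiagonal'_apply_eq]
        simp only [companionMatrix, Matrix.of_apply]
        split_ifs
        · rw [abs_neg]
          have := (hK i).2 r r.2
          linarith
        · rw [abs_one]; linarith
        · rw [abs_zero]; linarith
      · rw [Matrix.blockDiagonal'_apply_ne _ _ _ hij, abs_zero]; linarith
    · rw [Matrix.of_apply]
      split_ifs
      · exact hb _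
      · rw [abs_mul, abs_mul, hε, hε, one_mul, one_mul]; exact hb _
      all_goals rw [abs_zero]; exact hK0.le
  · by_contra hne
    refine hxy ?_
    obtain ⟨i, r⟩ := x
    obtain ⟨j, s⟩ := y
    simp only at hne
    have h1 : i ≠ j := by omega
    have h2 : i ≠ j + 1 := by omega
    have h3 : j ≠ i + 1 := by omega
    rw [Hmat, Matrix.add_apply, Matrix.blockDiagonal'_apply_ne _ _ _ h1, Matrix.of_apply]
    simp [h2, h3]

lemma isBandBounded_Gmat (h : D.Bounded) : IsBandBounded D.Gmat := by
  obtain ⟨K, hK⟩ := h.coeffs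
  obtain ⟨N, hN⟩ := h.degrees
  have hε : ∀ j, |D.ε j| = 1 := fun j => by rcases D.sign j with h | h <;> simp [h]
  refine isBandBounded_of_near h (c := N.factorial * (max 1 K) ^ N) (fun x y => ?_)
    fun x y hxy => ?_
  · obtain ⟨i, r⟩ := x
    obtain ⟨j, s⟩ := y
    by_cases hij : i = j
    · subst hij
      rw [Gmat, Matrix.blockDiagonal'_apply_eq, Matrix.smul_apply, smul_eq_mul, abs_mul, hε,
        one_mul]
      exact abs_inv_symmetrizator_le (D.monic i) (le_max_left _ _) (hN i)
        (fun r hr => ((hK i).2 r hr).trans (le_max_right _ _)) r s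
    · rw [Gmat, Matrix.blockDiagonal'_apply_ne _ _ _ hij, abs_zero]
      positivity
  · by_contra hne
    refine hxy ?_
    obtain ⟨i, r⟩ := x
    obtain ⟨j, s⟩ := y
    simp only at hne
    have h1 : i ≠ j := by omega
    rw [Gmat, Matrix.blockDiagonal'_apply_ne _ _ _ h1]

/-! ### The operator, the indefinite inner product and the Weyl function -/

variable (D)

/-- The generalized Jacobi operator `H` on `ℓ²`. -/
def H (h : D.Bounded) : EllTwo D.Idx →L[ℂ] EllTwo D.Idx :=
  matrixOp D.Hmat (isBandBounded_Hmat h)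

/-- The Gram operator `G` on `ℓ²`. -/
def G (h : D.Bounded) : EllTwo D.Idx →L[ℂ] EllTwo D.Idx :=
  matrixOp D.Gmat (isBandBounded_Gmat h)

/-- The indefinite inner product `[x, y] = (G x, y)`, linear in `x` and antilinear in `y`. -/
def indefInner (h : D.Bounded) (x y : EllTwo D.Idx) : ℂ := inner ℂ y (D.G h x)

/-- The vector `e = e_{0,0}`. -/
def e : EllTwo D.Idx := lp.single 2 ⟨0, ⟨0, D.deg_pos 0⟩⟩ 1

/-- The Weyl function `m(z) = [(H - z)⁻¹ e, e]`, meaningful for `z` in the resolvent set. -/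
def m (h : D.Bounded) (z : ℂ) : ℂ :=
  D.indefInner h (Ring.inverse (D.H h - algebraMap ℂ _ z) D.e) D.e

/-! ### The polynomials of the first and second kind -/

/-- The solution of the recurrence relations
`ε_{j-1} ε_j b_{j-1} u_{j-1} - p_j u_j + b_j u_{j+1} = 0`, `j ≥ 1`, with given `u_0`, `u_1`. -/
def recSol (u₀ u₁ : ℝ[X]) : ℕ → ℝ[X]
  | 0 => u₀
  | 1 => u₁
  | j + 2 => C (D.b (j + 1))⁻¹ *
      (D.p (j + 1) * recSol u₀ u₁ (j + 1) - C (D.ε j * D.ε (j + 1) * D.b j) * recSol u₀ u₁ j)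

/-- The polynomials `P_j`: `P_0 = 1`, `P_1 = p_0 / b_0`. -/
def P : ℕ → ℝ[X] := D.recSol 1 (C (D.b 0)⁻¹ * D.p 0)

/-- The polynomials `Q_j`: `Q_0 = 0`, `Q_1 = ε_0 / b_0`. -/
def Q : ℕ → ℝ[X] := D.recSol 0 (C (D.ε 0 / D.b 0))

/-- The rational function `-Q_j / P_j`. -/
def convergent (j : ℕ) (z : ℂ) : ℂ := -aeval z (D.Q j) / aeval z (D.P j)

end GenJacobi

/-! ### Padé approximants at infinity -/

/-- `f` is the `[L/M]` Padé approximant at infinity of `φ`: one has `f(z) = A(1/z) / B(1/z)` with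
polynomials `A`, `B` of degree at most `L`, `M` such that `B(0) ≠ 0`, and
`φ(z) - f(z) = O(z^{-(L+M+1)})` as `z → ∞`. -/
def IsPadeApproximant (φ : ℂ → ℂ) (L M : ℕ) (f : ℂ → ℂ) : Prop :=
  ∃ A B : ℂ[X], A.natDegree ≤ L ∧ B.natDegree ≤ M ∧ B.eval 0 ≠ 0 ∧
    (∀ z : ℂ, z ≠ 0 → f z = A.eval z⁻¹ / B.eval z⁻¹) ∧
    (fun z => φ z - f z) =O[Bornology.cobounded ℂ] fun z => (z ^ (L + M + 1))⁻¹

end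

noncomputable section

/-! ### Rows of band matrices -/

/-! Both claims come from one exact formula for the error. Let `x = (H - z)⁻¹ e`. Inside block `j`,
every row of `(H - z) x = e` except the first involves that block alone and expresses the
coordinates of `x` through the last one by Horner's scheme for `p_j`. The first row then becomes the
three-term recurrence for `ε_j x_{j,last}`. Since the first row of `E_{p_0}⁻¹` picks out the last
coordinate, `m(z) = ε_0 x_{0,last}`, and comparing initial data gives `ε_j x_{j,last} = Q_j + m P_j`
(`sign_mul_last_eq`). Hence `m + Q_j / P_j = ε_j x_{j,last} / P_j` (`m_sub_convergent`), and it
remains to bound the numerator above and the denominator below.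

At a fixed `z` in the resolvent set, `x` decays like `q ^ j` for some `q < 1`: conjugating `H - z`
by the weight `q ^ j` is a small perturbation when `q` is near 1, so invertibility survives
(`exists_norm_resolventVec_le`, a Combes–Thomas argument). The `P_j` cannot be square summable, for
they would yield an eigenvector of `H` at `z` (`not_summable_norm_P_sq`); so `|P_j| > s ^ j`
infinitely often for every `s < 1`. Taking `q < s < 1` gives the geometric subsequence.

As `z → ∞`, one application of `H` raises the position of a basis vector by at most one, so a
coordinate of `x` at position `t` is `O(z^{-(t+1)})` (`exists_norm_resolventVec_le_inv_pow`). The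
last vector of block `j` has position at least `n_j`, and `P_j` has degree exactly `n_j`, so the
error is `O(z^{-(2 n_j + 1)})`. -/

lemma IsBandBounded.exists_norm_matVec_le {ι : Type} {M : Matrix ι ι ℝ} (h : IsBandBounded M) :
    ∃ K : ℝ, 0 ≤ K ∧ ∀ (x : ι → ℂ) (i : ι) (B : ℝ), 0 ≤ B →
      (∀ j, M i j ≠ 0 → ‖x j‖ ≤ B) → ‖matVec M x i‖ ≤ K * B := by
  obtain ⟨c, d, hc, hrow, -⟩ := h
  refine ⟨d * |c|, by positivity, fun x i B hB hx => ?_⟩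
  have hfin : {j | M i j ≠ 0}.Finite := Set.finite_of_encard_le_coe (hrow i)
  rw [matVec_eq_sum M (S := hfin.toFinset) (by simp)]
  have hcard : (hfin.toFinset.card : ℝ) ≤ d := by
    have := hrow i
    rw [hfin.encard_eq_coe_toFinset_card] at this
    exact_mod_cast this
  calc ‖∑ j ∈ hfin.toFinset, (M i j : ℂ) * x j‖
      ≤ ∑ j ∈ hfin.toFinset, |c| * B := by
        refine (norm_sum_le _ _).trans (Finset.sum_le_sum fun j hj => ?_)
        rw [norm_mul, Complex.norm_real, Real.norm_eq_abs]
        exact mul_le_mul ((hc i j).trans (le_abs_self c)) (hx j (by simpa using hj))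
          (norm_nonneg _) (abs_nonneg c)
    _ = hfin.toFinset.card * (|c| * B) := by rw [Finset.sum_const, nsmul_eq_mul]
    _ ≤ d * (|c| * B) := by gcongr
    _ = d * |c| * B := by ring

/-- A weight that is constant on the support of a row factors out of that row. Applied to each block
diagonal, this computes the conjugation of `H` by powers of `q`. -/
lemma matVec_mul_eq {ι : Type} {M : Matrix ι ι ℝ} {i : ι} {a x : ι → ℂ} {α : ℂ}
    (h : ∀ j, M i j ≠ 0 → a j = α) : matVec M (fun j => a j * x j) i = α * matVec M x i := by
  simp only [matVec, ← tsum_mul_left]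
  refine tsum_congr fun j => ?_
  by_cases hj : M i j = 0
  · simp [hj]
  · rw [h j hj]; ring

lemma matVec_add_matrix {ι : Type} {M N : Matrix ι ι ℝ} (hM : IsBandBounded M)
    (hN : IsBandBounded N) (x : ι → ℂ) (i : ι) :
    matVec (M + N) x i = matVec M x i + matVec N x i := by
  classical
  obtain ⟨_, _, _, hM, -⟩ := hM
  obtain ⟨_, _, _, hN, -⟩ := hN
  have fM := Set.finite_of_encard_le_coe (hM i)
  have fN := Set.finite_of_encard_le_coe (hN i)
  rw [matVec_eq_sum M (S := fM.toFinset ∪ fN.toFinset) (fun j hj => by simp [hj]),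
    matVec_eq_sum N (S := fM.toFinset ∪ fN.toFinset) (fun j hj => by simp [hj]),
    matVec_eq_sum (M + N) (S := fM.toFinset ∪ fN.toFinset), ← Finset.sum_add_distrib]
  · exact Finset.sum_congr rfl fun j _ => by push_cast [Matrix.add_apply]; ring
  · intro j hj
    by_contra h
    simp only [Finset.mem_union, Set.Finite.mem_toFinset, Set.mem_ofPred_eq, not_or, not_not] at h
    exact hj (by simp [h.1, h.2])

lemma matVec_blockDiagonal' {k : ℕ → ℕ} (A : ∀ j, Matrix (Fin (k j)) (Fin (k j)) ℝ)
    (x : (Σ j, Fin (k j)) → ℂ) (j : ℕ) (r : Fin (k j)) :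
    matVec (Matrix.blockDiagonal' A) x ⟨j, r⟩ = ∑ c, (A j r c : ℂ) * x ⟨j, c⟩ := by
  classical
  rw [matVec_eq_sum _ (S := Finset.univ.map (Function.Embedding.sigmaMk j)), Finset.sum_map]
  · simp [Matrix.blockDiagonal'_apply_eq]
  · rintro ⟨i, c⟩ h
    by_cases hij : j = i
    · subst hij; simp
    · exact absurd (Matrix.blockDiagonal'_apply_ne _ _ _ hij) h

/-- As `q` is monic, the last row of `E_q` is the first unit row vector; multiplying by `E_q⁻¹` on
the right shows that the first row of `E_q⁻¹` is the last unit row vector. -/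
lemma inv_symmetrizator_first_row {q : ℝ[X]} (hq : q.Monic) (h0 : 0 < q.natDegree)
    (c : Fin q.natDegree) : (symmetrizator q)⁻¹ ⟨0, h0⟩ c =
      if (c : ℕ) + 1 = q.natDegree then 1 else 0 := by
  have hdet : IsUnit (symmetrizator q).det := by
    have := abs_det_symmetrizator hq
    refine isUnit_iff_ne_zero.2 fun h => ?_
    simp [h] at this
  have hrow : Matrix.vecMul (Pi.single ⟨q.natDegree - 1, by omega⟩ 1) (symmetrizator q)
      = Pi.single ⟨0, h0⟩ 1 := by
    ext d
    rw [Matrix.single_one_vecMul]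
    simp only [Matrix.row, symmetrizator, Matrix.of_apply]
    by_cases hd : (d : ℕ) = 0
    · have : d = ⟨0, h0⟩ := Fin.ext hd
      subst this
      have h1 : q.natDegree - 1 + 0 + 1 = q.natDegree := by omega
      simp [h1, hq.coeff_natDegree]
    · rw [Pi.single_eq_of_ne (fun h => hd (by simp [h]))]
      exact coeff_eq_zero_of_natDegree_lt (by omega)
  have h2 := congrArg (fun v => Matrix.vecMul v (symmetrizator q)⁻¹) hrow
  rw [Matrix.vecMul_vecMul, Matrix.mul_nonsing_inv _ hdet, Matrix.vecMul_one,
    Matrix.single_one_vecMul] at h2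
  have h3 := congrFun h2 c
  simp only [Matrix.row] at h3
  rw [← h3, Pi.single_apply]
  refine if_congr ?_ rfl rfl
  rw [Fin.ext_iff]
  simp only
  omega

namespace GenJacobi

variable (D : GenJacobi)

/-! ### The three block diagonals of the generalized Jacobi matrix -/

/-- The index of the last basis vector of the `j`-th block. -/
def last (j : ℕ) : D.Idx := ⟨j, ⟨(D.p j).natDegree - 1, Nat.sub_lt (D.deg_pos j) one_pos⟩⟩

/-- The diagonal blocks of `H`. -/
def diagMat : Matrix D.Idx D.Idx ℝ := Matrix.blockDiagonal' fun j => companionMatrix (D.p j)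

/-- The subdiagonal blocks of `H`. -/
def lowerMat : Matrix D.Idx D.Idx ℝ := Matrix.of fun x y =>
  if (x.2 : ℕ) = 0 ∧ (y.2 : ℕ) + 1 = (D.p y.1).natDegree ∧ x.1 = y.1 + 1 then D.b y.1 else 0

/-- The superdiagonal blocks of `H`. -/
def upperMat : Matrix D.Idx D.Idx ℝ := Matrix.of fun x y =>
  if (x.2 : ℕ) = 0 ∧ (y.2 : ℕ) + 1 = (D.p y.1).natDegree ∧ y.1 = x.1 + 1 then
    D.ε x.1 * D.ε y.1 * D.b x.1 else 0

lemma Hmat_eq : D.Hmat = D.diagMat + D.lowerMat + D.upperMat := by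
  ext x y
  simp only [Hmat, diagMat, lowerMat, upperMat, Matrix.add_apply, Matrix.of_apply, add_assoc]
  congr 1
  by_cases h1 : (x.2 : ℕ) = 0 ∧ (y.2 : ℕ) + 1 = (D.p y.1).natDegree
  · by_cases h2 : x.1 = y.1 + 1
    · have h3 : y.1 ≠ x.1 + 1 := by omega
      rw [if_pos h1, if_pos h2, if_pos ⟨h1.1, h1.2, h2⟩, if_neg (fun h => h3 h.2.2), add_zero]
    · rw [if_pos h1, if_neg h2, if_neg (c := _ ∧ _ ∧ x.1 = y.1 + 1) (fun h => h2 h.2.2), zero_add]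
      by_cases h3 : y.1 = x.1 + 1
      · rw [if_pos h3, if_pos ⟨h1.1, h1.2, h3⟩]
      · rw [if_neg h3, if_neg (fun h => h3 h.2.2)]
  · rw [if_neg h1, if_neg (fun h => h1 ⟨h.1, h.2.1⟩), if_neg (fun h => h1 ⟨h.1, h.2.1⟩), add_zero]

variable {D}

lemma eq_last_iff {y : D.Idx} {j : ℕ} :
    y = D.last j ↔ (y.2 : ℕ) + 1 = (D.p y.1).natDegree ∧ y.1 = j := by
  obtain ⟨i, c⟩ := y
  have := D.deg_pos i
  constructor
  · rintro h
    cases h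
    exact ⟨by simp only; omega, rfl⟩
  · rintro ⟨h, rfl⟩
    simp only [last, Sigma.mk.injEq, heq_eq_eq, true_and, Fin.ext_iff]
    simp only at h
    omega

lemma diagMat_ne_zero {x y : D.Idx} (h : D.diagMat x y ≠ 0) : y.1 = x.1 := by
  by_contra hne
  obtain ⟨i, r⟩ := x
  obtain ⟨j, s⟩ := y
  exact h (Matrix.blockDiagonal'_apply_ne _ _ _ fun hij => hne hij.symm)

lemma lowerMat_ne_zero {x y : D.Idx} (h : D.lowerMat x y ≠ 0) :
    (x.2 : ℕ) = 0 ∧ (y.2 : ℕ) + 1 = (D.p y.1).natDegree ∧ x.1 = y.1 + 1 := by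
  by_contra hne
  exact h (if_neg hne)

lemma upperMat_ne_zero {x y : D.Idx} (h : D.upperMat x y ≠ 0) :
    (x.2 : ℕ) = 0 ∧ (y.2 : ℕ) + 1 = (D.p y.1).natDegree ∧ y.1 = x.1 + 1 := by
  by_contra hne
  exact h (if_neg hne)

lemma abs_sign (D : GenJacobi) (j : ℕ) : |D.ε j| = 1 := by
  rcases D.sign j with h | h <;> simp [h]

lemma sign_mul_sign (D : GenJacobi) (j : ℕ) : (D.ε j : ℂ) * D.ε j = 1 := by
  rcases D.sign j with h | h <;> simp [h]

lemma isBandBounded_lowerMat (h : D.Bounded) : IsBandBounded D.lowerMat := by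
  obtain ⟨K, hK⟩ := h.coeffs
  have hK0 : 0 < K := (D.b_pos 0).trans_le (hK 0).1
  refine isBandBounded_of_near h (c := K) (fun x y => ?_) fun x y hxy => ?_
  · rw [lowerMat, Matrix.of_apply]
    split_ifs
    · rw [abs_of_pos (D.b_pos _)]; exact (hK _).1
    · rw [abs_zero]; exact hK0.le
  · have := (lowerMat_ne_zero hxy).2.2
    omega

lemma isBandBounded_upperMat (h : D.Bounded) : IsBandBounded D.upperMat := by
  obtain ⟨K, hK⟩ := h.coeffs
  have hK0 : 0 < K := (D.b_pos 0).trans_le (hK 0).1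
  refine isBandBounded_of_near h (c := K) (fun x y => ?_) fun x y hxy => ?_
  · rw [upperMat, Matrix.of_apply]
    split_ifs
    · rw [abs_mul, abs_mul, D.abs_sign, D.abs_sign, one_mul, one_mul, abs_of_pos (D.b_pos _)]
      exact (hK _).1
    · rw [abs_zero]; exact hK0.le
  · have := (upperMat_ne_zero hxy).2.2
    omega

lemma isBandBounded_diagMat (h : D.Bounded) : IsBandBounded D.diagMat := by
  obtain ⟨K, hK⟩ := h.coeffs
  have hK0 : 0 < K := (D.b_pos 0).trans_le (hK 0).1
  refine isBandBounded_of_near h (c := K + 1) (fun x y => ?_) fun x y hxy => ?_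
  · obtain ⟨i, r⟩ := x
    obtain ⟨j, s⟩ := y
    by_cases hij : i = j
    · subst hij
      rw [diagMat, Matrix.blockDiagonal'_apply_eq]
      simp only [companionMatrix, Matrix.of_apply]
      split_ifs
      · rw [abs_neg]
        have := (hK i).2 r r.2
        linarith
      · rw [abs_one]; linarith
      · rw [abs_zero]; linarith
    · rw [diagMat, Matrix.blockDiagonal'_apply_ne _ _ _ hij, abs_zero]; linarith
  · have := diagMat_ne_zero hxy
    omega

lemma matVec_Hmat (h : D.Bounded) (x : D.Idx → ℂ) (i : D.Idx) :
    matVec D.Hmat x i = matVec D.diagMat x i + matVec D.lowerMat x i + matVec D.upperMat x i := by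
  have h12 : IsBandBounded (D.diagMat + D.lowerMat) := by
    have hH := isBandBounded_Hmat h
    obtain ⟨c, d, hc, -, -⟩ := isBandBounded_diagMat h
    obtain ⟨c', d', hc', -, -⟩ := isBandBounded_lowerMat h
    refine isBandBounded_of_near h (c := c + c')
      (fun x y => (abs_add_le _ _).trans (add_le_add (hc x y) (hc' x y))) fun x y hxy => ?_
    by_cases h1 : D.diagMat x y = 0
    · have h2 : D.lowerMat x y ≠ 0 := fun h2 => hxy (by simp [h1, h2])
      have := (lowerMat_ne_zero h2).2.2
      omega
    · have := diagMat_ne_zero h1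
      omega
  rw [Hmat_eq, matVec_add_matrix h12 (isBandBounded_upperMat h),
    matVec_add_matrix (isBandBounded_diagMat h) (isBandBounded_lowerMat h)]

lemma matVec_diagMat (x : D.Idx → ℂ) (j : ℕ) (r : Fin (D.p j).natDegree) :
    matVec D.diagMat x ⟨j, r⟩ = (if 0 < (r : ℕ) then x ⟨j, ⟨r - 1, by omega⟩⟩ else 0)
      - (D.p j).coeff r * x (D.last j) := by
  rw [diagMat, matVec_blockDiagonal']
  have hr := r.2
  -- A companion row is a sum of two Kronecker deltas. For `r = 0` the second index truncates to
  -- `0`, and the inner condition `0 < r` removes this spurious term.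
  have key : ∀ c : Fin (D.p j).natDegree, ((companionMatrix (D.p j) r c : ℝ) : ℂ) * x ⟨j, c⟩
      = (if c = ⟨(D.p j).natDegree - 1, by omega⟩ then -((D.p j).coeff r : ℂ) * x ⟨j, c⟩ else 0)
        + (if c = ⟨(r : ℕ) - 1, by omega⟩ then (if 0 < (r : ℕ) then x ⟨j, c⟩ else 0) else 0) := by
    intro c
    have hc := c.2
    simp only [companionMatrix, Matrix.of_apply, Fin.ext_iff]
    by_cases h1 : (c : ℕ) + 1 = (D.p j).natDegree
    · have h2 : ¬((c : ℕ) = r - 1 ∧ 0 < (r : ℕ)) := by omega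
      rw [if_pos h1, if_pos (by omega), ← ite_and, if_neg h2]
      push_cast; ring
    · have h3 : ¬((c : ℕ) = (D.p j).natDegree - 1) := by omega
      rw [if_neg h1, if_neg h3, ← ite_and]
      by_cases h2 : (r : ℕ) = c + 1
      · rw [if_pos h2, if_pos (by omega)]; push_cast; ring
      · have h4 : ¬((c : ℕ) = r - 1 ∧ 0 < (r : ℕ)) := by omega
        rw [if_neg h2, if_neg h4]; push_cast; ring
  rw [Finset.sum_congr rfl fun c _ => key c, Finset.sum_add_distrib, Finset.sum_ite_eq',
    Finset.sum_ite_eq', if_pos (Finset.mem_univ _), if_pos (Finset.mem_univ _)]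
  change -((D.p j).coeff r : ℂ) * x (D.last j) + _ = _
  ring

lemma matVec_lowerMat_zero (x : D.Idx → ℂ) (r : Fin (D.p 0).natDegree) :
    matVec D.lowerMat x ⟨0, r⟩ = 0 := by
  rw [matVec_eq_sum _ (S := ∅), Finset.sum_empty]
  intro y hy
  have := (lowerMat_ne_zero hy).2.2
  simp at this

lemma matVec_lowerMat_succ (x : D.Idx → ℂ) (j : ℕ) (r : Fin (D.p (j + 1)).natDegree) :
    matVec D.lowerMat x ⟨j + 1, r⟩ = if (r : ℕ) = 0 then D.b j * x (D.last j) else 0 := by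
  rw [matVec_eq_sum _ (S := {D.last j}), Finset.sum_singleton]
  · have hl := (eq_last_iff (D := D) (y := D.last j) (j := j)).1 rfl
    by_cases hr : (r : ℕ) = 0
    · rw [if_pos hr, lowerMat, Matrix.of_apply, if_pos ⟨hr, hl.1, rfl⟩, hl.2]
    · rw [if_neg hr, lowerMat, Matrix.of_apply, if_neg (fun h => hr h.1)]
      simp
  · intro y hy
    have := lowerMat_ne_zero hy
    rw [Finset.mem_singleton, eq_last_iff]
    simp only at this
    omega

lemma matVec_upperMat (x : D.Idx → ℂ) (j : ℕ) (r : Fin (D.p j).natDegree) :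
    matVec D.upperMat x ⟨j, r⟩ =
      if (r : ℕ) = 0 then D.ε j * D.ε (j + 1) * D.b j * x (D.last (j + 1)) else 0 := by
  rw [matVec_eq_sum _ (S := {D.last (j + 1)}), Finset.sum_singleton]
  · have hl := (eq_last_iff (D := D) (y := D.last (j + 1)) (j := j + 1)).1 rfl
    by_cases hr : (r : ℕ) = 0
    · rw [if_pos hr, upperMat, Matrix.of_apply, if_pos ⟨hr, hl.1, rfl⟩, hl.2]
      push_cast; ring
    · rw [if_neg hr, upperMat, Matrix.of_apply, if_neg (fun h => hr h.1)]
      simp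
  · intro y hy
    have := upperMat_ne_zero hy
    rw [Finset.mem_singleton, eq_last_iff]
    exact this.2

lemma matVec_Gmat_zero (x : D.Idx → ℂ) :
    matVec D.Gmat x ⟨0, ⟨0, D.deg_pos 0⟩⟩ = D.ε 0 * x (D.last 0) := by
  have h0 := D.deg_pos 0
  rw [Gmat, matVec_blockDiagonal',
    Finset.sum_eq_single (⟨(D.p 0).natDegree - 1, by omega⟩ : Fin (D.p 0).natDegree)]
  · rw [Matrix.smul_apply, inv_symmetrizator_first_row (D.monic 0), if_pos (by simp only; omega)]
    simp [last]
  · intro c _ hc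
    rw [Matrix.smul_apply, inv_symmetrizator_first_row (D.monic 0), if_neg]
    · simp
    · intro h
      exact hc (Fin.ext (by simp only; omega))
  · simp

/-- Pairing with `e` reads off the first coordinate of `G x`, which by the shape of `E_{p_0}⁻¹` is
`ε_0` times the last coordinate of block `0`. -/
lemma m_eq (h : D.Bounded) (z : ℂ) : D.m h z =
    D.ε 0 * Ring.inverse (D.H h - algebraMap ℂ _ z) D.e (D.last 0) := by
  rw [m, indefInner, e, lp.inner_single_left]
  rw [← matVec_Gmat_zero, G]
  simp only [matrixOp_apply, matVec]
  simp

end GenJacobi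

/-! ### Truncated evaluation of polynomials -/

/-- The value at `z` of the polynomial `(q - (q_0 + ⋯ + q_{r-1} λ^{r-1})) / λ^r`. -/
def tailEval (q : ℝ[X]) (z : ℂ) (r : ℕ) : ℂ :=
  ∑ i ∈ Finset.range (q.natDegree + 1 - r), (q.coeff (r + i) : ℂ) * z ^ i

lemma tailEval_zero (q : ℝ[X]) (z : ℂ) : tailEval q z 0 = aeval z q := by
  simp [tailEval, aeval_eq_sum_range, Algebra.smul_def]

/-- One step of Horner's scheme. -/
lemma tailEval_eq (q : ℝ[X]) (z : ℂ) {r : ℕ} (hr : r ≤ q.natDegree) :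
    tailEval q z r = z * tailEval q z (r + 1) + q.coeff r := by
  have h1 : q.natDegree + 1 - r = (q.natDegree + 1 - (r + 1)) + 1 := by omega
  rw [tailEval, h1, Finset.sum_range_succ', tailEval, Finset.mul_sum]
  congr 1
  · refine Finset.sum_congr rfl fun i _ => ?_
    rw [show r + (i + 1) = r + 1 + i by ring]
    ring
  · simp

lemma tailEval_natDegree {q : ℝ[X]} (hq : q.Monic) (z : ℂ) : tailEval q z q.natDegree = 1 := by
  simp [tailEval, hq.coeff_natDegree]

lemma norm_tailEval_le {q : ℝ[X]} {K : ℝ} {N : ℕ} (hN : q.natDegree ≤ N)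
    (hc : ∀ r, |q.coeff r| ≤ K) (z : ℂ) (r : ℕ) :
    ‖tailEval q z r‖ ≤ (N + 1) * (K * (1 + ‖z‖) ^ N) := by
  have hK : 0 ≤ K := (abs_nonneg _).trans (hc 0)
  have h1 : (1 : ℝ) ≤ 1 + ‖z‖ := by linarith [norm_nonneg z]
  calc ‖tailEval q z r‖
      ≤ ∑ i ∈ Finset.range (q.natDegree + 1 - r), K * (1 + ‖z‖) ^ N := by
        refine (norm_sum_le _ _).trans (Finset.sum_le_sum fun i hi => ?_)
        rw [norm_mul, Complex.norm_real, Real.norm_eq_abs, norm_pow]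
        have hi' := Finset.mem_range.1 hi
        refine mul_le_mul (hc _) ?_ (by positivity) hK
        calc ‖z‖ ^ i ≤ (1 + ‖z‖) ^ i := by gcongr; linarith
          _ ≤ (1 + ‖z‖) ^ N := pow_le_pow_right₀ h1 (by omega)
    _ = ((q.natDegree + 1 - r : ℕ) : ℝ) * (K * (1 + ‖z‖) ^ N) := by
        rw [Finset.sum_const, Finset.card_range, nsmul_eq_mul]
    _ ≤ (N + 1) * (K * (1 + ‖z‖) ^ N) := by
        gcongr
        have : q.natDegree + 1 - r ≤ N + 1 := by omega
        exact_mod_cast this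

namespace GenJacobi

variable {D : GenJacobi}

/-! ### Elimination of the unknowns inside the blocks -/

/-- The contribution of the block row `j` to the block row `j + 1`. -/
def fromBelow (D : GenJacobi) (y : ℕ → ℂ) : ℕ → ℂ
  | 0 => 0
  | j + 1 => D.b j * y j

lemma matVec_Hmat_pos (h : D.Bounded) (x : D.Idx → ℂ) (j : ℕ) (r : ℕ)
    (hr : r + 1 < (D.p j).natDegree) : matVec D.Hmat x ⟨j, ⟨r + 1, hr⟩⟩ =
      x ⟨j, ⟨r, by omega⟩⟩ - (D.p j).coeff (r + 1) * x (D.last j) := by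
  rw [matVec_Hmat h, matVec_diagMat, matVec_upperMat, if_pos (by simp), if_neg (by simp)]
  have : matVec D.lowerMat x ⟨j, ⟨r + 1, hr⟩⟩ = 0 := by
    cases j with
    | zero => exact matVec_lowerMat_zero _ _
    | succ j => rw [matVec_lowerMat_succ, if_neg (by simp)]
  rw [this]
  simp

lemma matVec_Hmat_zero (h : D.Bounded) (x : D.Idx → ℂ) (j : ℕ) :
    matVec D.Hmat x ⟨j, ⟨0, D.deg_pos j⟩⟩ = fromBelow D (fun i => x (D.last i)) j
      - (D.p j).coeff 0 * x (D.last j) + D.ε j * D.ε (j + 1) * D.b j * x (D.last (j + 1)) := by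
  rw [matVec_Hmat h, matVec_diagMat, matVec_upperMat, if_neg (by simp), if_pos (by simp)]
  cases j with
  | zero => rw [matVec_lowerMat_zero]; simp [fromBelow]
  | succ j => rw [matVec_lowerMat_succ, if_pos rfl]; simp [fromBelow]; ring

/-- Rows `r ≥ 1` of a block have no coupling to other blocks and say `x_r = z x_{r+1} + p_{j,r+1}
x_last`, which is the Horner recursion of the tails, started from the leading coefficient `1`. -/
lemma apply_eq_tailEval_mul (h : D.Bounded) {x : D.Idx → ℂ} {z : ℂ} {j : ℕ}
    (hx : ∀ r (hr : r + 1 < (D.p j).natDegree),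
      matVec D.Hmat x ⟨j, ⟨r + 1, hr⟩⟩ - z * x ⟨j, ⟨r + 1, hr⟩⟩ = 0) :
    ∀ r (hr : r < (D.p j).natDegree),
      x ⟨j, ⟨r, hr⟩⟩ = tailEval (D.p j) z (r + 1) * x (D.last j) := by
  -- Here `i` is the distance of `r` from the last coordinate, so that induction runs upwards
  -- through the block from its end.
  suffices H : ∀ i r, r + 1 + i = (D.p j).natDegree → ∀ hr : r < (D.p j).natDegree,
      x ⟨j, ⟨r, hr⟩⟩ = tailEval (D.p j) z (r + 1) * x (D.last j) from
    fun r hr => H ((D.p j).natDegree - (r + 1)) r (by omega) hr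
  intro i
  induction i with
  | zero =>
    intro r hri hr
    rw [add_zero] at hri
    rw [hri, tailEval_natDegree (D.monic j), one_mul]
    congr 1
    exact eq_last_iff.2 ⟨hri, rfl⟩
  | succ i ih =>
    intro r hri hr
    have h1 := hx r (by omega)
    rw [matVec_Hmat_pos h, ih (r + 1) (by omega) (by omega)] at h1
    rw [tailEval_eq _ _ (by omega : r + 1 ≤ (D.p j).natDegree)]
    linear_combination h1

/-! ### Recurrence relations -/

lemma aeval_recSol_add_two (D : GenJacobi) (u₀ u₁ : ℝ[X]) (z : ℂ) (j : ℕ) :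
    D.b (j + 1) * aeval z (D.recSol u₀ u₁ (j + 2)) =
      aeval z (D.p (j + 1)) * aeval z (D.recSol u₀ u₁ (j + 1))
        - D.ε j * D.ε (j + 1) * D.b j * aeval z (D.recSol u₀ u₁ j) := by
  have hb : (D.b (j + 1) : ℂ) ≠ 0 := by exact_mod_cast (D.b_pos _).ne'
  simp only [recSol, map_mul, map_sub, aeval_C, Complex.coe_algebraMap, Complex.ofReal_inv]
  field_simp

lemma aeval_P_zero (D : GenJacobi) (z : ℂ) : aeval z (D.P 0) = 1 := by simp [P, recSol]

lemma aeval_Q_zero (D : GenJacobi) (z : ℂ) : aeval z (D.Q 0) = 0 := by simp [Q, recSol]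

lemma aeval_P_one (D : GenJacobi) (z : ℂ) : D.b 0 * aeval z (D.P 1) = aeval z (D.p 0) := by
  have hb : (D.b 0 : ℂ) ≠ 0 := by exact_mod_cast (D.b_pos _).ne'
  simp only [P, recSol, map_mul, aeval_C, Complex.coe_algebraMap, Complex.ofReal_inv]
  field_simp

lemma aeval_Q_one (D : GenJacobi) (z : ℂ) : D.b 0 * aeval z (D.Q 1) = D.ε 0 := by
  have hb : (D.b 0 : ℂ) ≠ 0 := by exact_mod_cast (D.b_pos _).ne'
  simp only [Q, recSol, aeval_C, Complex.coe_algebraMap, Complex.ofReal_div]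
  field_simp

lemma e_apply_zero (D : GenJacobi) : D.e ⟨0, ⟨0, D.deg_pos 0⟩⟩ = 1 := by
  simp [e]

lemma e_apply_ne {i : D.Idx} (hi : i ≠ ⟨0, ⟨0, D.deg_pos 0⟩⟩) : D.e i = 0 := by
  rw [e, lp.single_apply_ne]
  exact hi

lemma e_apply_succ (D : GenJacobi) (j : ℕ) (r : Fin (D.p (j + 1)).natDegree) :
    D.e ⟨j + 1, r⟩ = 0 :=
  e_apply_ne fun h => by simpa using congrArg Sigma.fst h

lemma e_apply_pos (D : GenJacobi) (j r : ℕ) (hr : r + 1 < (D.p j).natDegree) :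
    D.e ⟨j, ⟨r + 1, hr⟩⟩ = 0 := by
  cases j with
  | zero => exact e_apply_ne fun h => by simp at h
  | succ j => exact e_apply_succ _ _ _

/-- The last components of the blocks of the solution of `(H - z) x = e` are, up to signs, the
values of `Q_j + m P_j`. -/
lemma sign_mul_last_eq (h : D.Bounded) {x : D.Idx → ℂ} {z : ℂ}
    (hx : ∀ i, matVec D.Hmat x i - z * x i = D.e i) (j : ℕ) :
    D.ε j * x (D.last j) =
      aeval z (D.Q j) + D.ε 0 * x (D.last 0) * aeval z (D.P j) := by
  -- Substituting the Horner tail for the first coordinate reassembles the full value `p_j(z)`.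
  have row : ∀ j, fromBelow D (fun i => x (D.last i)) j - aeval z (D.p j) * x (D.last j)
      + D.ε j * D.ε (j + 1) * D.b j * x (D.last (j + 1)) = D.e ⟨j, ⟨0, D.deg_pos j⟩⟩ := by
    intro j
    have h1 := hx ⟨j, ⟨0, D.deg_pos j⟩⟩
    rw [matVec_Hmat_zero h, apply_eq_tailEval_mul h (z := z)
      (fun r hr => (hx _).trans (e_apply_pos D j r hr)) 0 (D.deg_pos j)] at h1
    rw [← h1, ← tailEval_zero, tailEval_eq _ _ (Nat.zero_le _)]
    ring
  have hb : ∀ j, (D.b j : ℂ) ≠ 0 := fun j => by exact_mod_cast (D.b_pos j).ne'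
  induction j using Nat.twoStepInduction with
  | zero => rw [aeval_P_zero, aeval_Q_zero]; ring
  | one =>
    have h1 := row 0
    rw [e_apply_zero] at h1
    simp only [fromBelow, zero_add] at h1
    refine mul_left_cancel₀ (hb 0) ?_
    linear_combination D.ε 0 * h1 - aeval_Q_one D z - D.ε 0 * x (D.last 0) * aeval_P_one D z
      - D.b 0 * D.ε 1 * x (D.last 1) * D.sign_mul_sign 0
  | more j ih0 ih1 =>
    have h1 := row (j + 1)
    rw [e_apply_succ] at h1
    simp only [fromBelow] at h1
    have hP := aeval_recSol_add_two D 1 (C (D.b 0)⁻¹ * D.p 0) z j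
    have hQ := aeval_recSol_add_two D 0 (C (D.ε 0 / D.b 0)) z j
    change _ * aeval z (D.P (j + 2)) = _ * aeval z (D.P (j + 1)) - _ * aeval z (D.P j) at hP
    change _ * aeval z (D.Q (j + 2)) = _ * aeval z (D.Q (j + 1)) - _ * aeval z (D.Q j) at hQ
    refine mul_left_cancel₀ (hb (j + 1)) ?_
    -- Multiplied by `ε_{j+1}`, and with `ε² = 1`, the row is the recurrence of `P` and `Q` in the
    -- unknowns `ε_j x_{j,last}`.
    linear_combination D.ε (j + 1) * h1 - hQ - D.ε 0 * x (D.last 0) * hP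
      + aeval z (D.p (j + 1)) * ih1 - D.ε j * D.ε (j + 1) * D.b j * ih0
      - D.b (j + 1) * D.ε (j + 2) * x (D.last (j + 2)) * D.sign_mul_sign (j + 1)
      + D.ε (j + 1) * D.b j * x (D.last j) * D.sign_mul_sign j

/-- The formal solution of `(H - z) x = 0` built from the polynomials of the first kind. -/
def formalEigenvector (D : GenJacobi) (z : ℂ) (i : D.Idx) : ℂ :=
  D.ε i.1 * aeval z (D.P i.1) * tailEval (D.p i.1) z (i.2 + 1)

lemma formalEigenvector_last (D : GenJacobi) (z : ℂ) (j : ℕ) :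
    formalEigenvector D z (D.last j) = D.ε j * aeval z (D.P j) := by
  have := D.deg_pos j
  simp only [formalEigenvector, last]
  rw [Nat.sub_add_cancel (by omega), tailEval_natDegree (D.monic j), mul_one]

/-- The elimination read backwards: inner rows are Horner steps and first rows are the recurrence.
In block `0` the equation is homogeneous precisely because `P_0 = 1` and `b_0 P_1 = p_0`. -/
lemma matVec_formalEigenvector (h : D.Bounded) (z : ℂ) (i : D.Idx) :
    matVec D.Hmat (formalEigenvector D z) i = z * formalEigenvector D z i := by
  obtain ⟨j, r, hr⟩ := i
  cases r with
  | succ r =>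
    rw [matVec_Hmat_pos h, formalEigenvector_last]
    simp only [formalEigenvector]
    rw [tailEval_eq _ _ (by omega : r + 1 ≤ (D.p j).natDegree)]
    ring
  | zero =>
    rw [matVec_Hmat_zero h, formalEigenvector_last, formalEigenvector_last]
    have h0 : aeval z (D.p j) = z * tailEval (D.p j) z 1 + (D.p j).coeff 0 := by
      rw [← tailEval_zero, tailEval_eq _ _ (Nat.zero_le _)]
    have hd : formalEigenvector D z ⟨j, ⟨0, hr⟩⟩ =
      D.ε j * aeval z (D.P j) * tailEval (D.p j) z 1 := rfl
    rw [hd]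
    cases j with
    | zero =>
      simp only [fromBelow]
      have h1 := aeval_P_one D z
      have h2 := aeval_P_zero D z
      simp only [zero_add] at *
      linear_combination D.ε 0 * h1 + D.ε 0 * h0
        + D.ε 0 * D.b 0 * aeval z (D.P 1) * D.sign_mul_sign 1
        - D.ε 0 * (z * tailEval (D.p 0) z 1 + (D.p 0).coeff 0) * h2
    | succ j =>
      simp only [fromBelow, formalEigenvector_last]
      have hP := aeval_recSol_add_two D 1 (C (D.b 0)⁻¹ * D.p 0) z j
      change _ * aeval z (D.P (j + 2)) = _ * aeval z (D.P (j + 1)) - _ * aeval z (D.P j) at hP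
      linear_combination D.ε (j + 1) * hP + D.ε (j + 1) * aeval z (D.P (j + 1)) * h0
        + D.ε (j + 1) * D.b (j + 1) * aeval z (D.P (j + 2)) * D.sign_mul_sign (j + 2)
        - D.ε j * D.b j * aeval z (D.P j) * D.sign_mul_sign (j + 1)

end GenJacobi

namespace GenJacobi

variable {D : GenJacobi}

/-! ### The solution of `(H - z) x = e` -/

lemma e_ne_zero (D : GenJacobi) : D.e ≠ 0 := fun h => by
  have h1 := D.e_apply_zero
  rw [h] at h1
  simp at h1

lemma isUnit_sub_of_mem_resolventSet (h : D.Bounded) {z : ℂ} (hz : z ∈ resolventSet ℂ (D.H h)) :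
    IsUnit (D.H h - algebraMap ℂ _ z) := by
  rw [← neg_sub]
  exact (spectrum.mem_resolventSet_iff.1 hz).neg

lemma H_sub_apply (h : D.Bounded) (z : ℂ) (x : EllTwo D.Idx) (i : D.Idx) :
    (D.H h - algebraMap ℂ _ z) x i = matVec D.Hmat x i - z * x i := by
  rw [Algebra.algebraMap_eq_smul_one]
  rfl

/-- The vector `(H - z)⁻¹ e`. -/
def resolventVec (h : D.Bounded) (z : ℂ) : EllTwo D.Idx :=
  Ring.inverse (D.H h - algebraMap ℂ _ z) D.e

lemma H_sub_resolventVec (h : D.Bounded) {z : ℂ} (hz : z ∈ resolventSet ℂ (D.H h)) :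
    (D.H h - algebraMap ℂ _ z) (resolventVec h z) = D.e := by
  have := congrArg (fun T => T D.e)
    (Ring.mul_inverse_cancel _ (isUnit_sub_of_mem_resolventSet h hz))
  exact this

lemma eq_resolventVec (h : D.Bounded) {z : ℂ} (hz : z ∈ resolventSet ℂ (D.H h))
    {x : EllTwo D.Idx} (hx : (D.H h - algebraMap ℂ _ z) x = D.e) : x = resolventVec h z := by
  have := congrArg (fun T => T x)
    (Ring.inverse_mul_cancel _ (isUnit_sub_of_mem_resolventSet h hz))
  rw [resolventVec, ← hx]
  exact this.symm

lemma matVec_resolventVec (h : D.Bounded) {z : ℂ} (hz : z ∈ resolventSet ℂ (D.H h)) (i : D.Idx) :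
    matVec D.Hmat (resolventVec h z) i - z * resolventVec h z i = D.e i := by
  rw [← H_sub_apply h, H_sub_resolventVec h hz]

lemma m_sub_convergent (h : D.Bounded) {z : ℂ} (hz : z ∈ resolventSet ℂ (D.H h)) {j : ℕ}
    (hP : aeval z (D.P j) ≠ 0) :
    D.m h z - D.convergent j z = D.ε j * resolventVec h z (D.last j) / aeval z (D.P j) := by
  rw [sign_mul_last_eq h (matVec_resolventVec h hz), convergent,
    show D.m h z = D.ε 0 * resolventVec h z (D.last 0) from m_eq h z]
  field_simp
  ring

lemma norm_m_sub_convergent (h : D.Bounded) {z : ℂ} (hz : z ∈ resolventSet ℂ (D.H h)) {j : ℕ}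
    (hP : aeval z (D.P j) ≠ 0) :
    ‖D.m h z - D.convergent j z‖ = ‖resolventVec h z (D.last j)‖ / ‖aeval z (D.P j)‖ := by
  rw [m_sub_convergent h hz hP, norm_div, norm_mul, Complex.norm_real, Real.norm_eq_abs,
    D.abs_sign, one_mul]

/-! ### Exponential decay of the resolvent -/

/-- Combes–Thomas argument. With `W = diag(q ^ j)` on block `j`, formally `W⁻¹ (H - z) W` multiplies
the lower blocks by `q⁻¹` and the upper blocks by `q`. This family is norm continuous at `q = 1` and
invertible there. Because `W⁻¹` is unbounded for `q < 1`, the conjugation is verified row by row. -/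
lemma exists_norm_resolventVec_le (h : D.Bounded) {z : ℂ} (hz : z ∈ resolventSet ℂ (D.H h)) :
    ∃ q C : ℝ, 0 < q ∧ q < 1 ∧ 0 ≤ C ∧ ∀ i, ‖resolventVec h z i‖ ≤ C * q ^ i.1 := by
  set A := D.H h - algebraMap ℂ _ z with hA
  set L := matrixOp D.lowerMat (isBandBounded_lowerMat h) with hL
  set U := matrixOp D.upperMat (isBandBounded_upperMat h) with hU
  let f : ℝ → EllTwo D.Idx →L[ℂ] EllTwo D.Idx := fun q =>
    A + ((q : ℂ)⁻¹ - 1) • L + ((q : ℂ) - 1) • U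
  have hf1 : f 1 = A := by simp [f]
  have hf : ContinuousAt f 1 := by
    have h1 : ContinuousAt (fun q : ℝ => (q : ℂ)) 1 := Complex.continuous_ofReal.continuousAt
    have h2 : ContinuousAt (fun q : ℝ => (q : ℂ)⁻¹) 1 := h1.inv₀ (by simp)
    exact (continuousAt_const.add ((h2.sub continuousAt_const).smul continuousAt_const)).add
      ((h1.sub continuousAt_const).smul continuousAt_const)
  have hev : ∀ᶠ q in nhds (1 : ℝ), IsUnit (f q) := by
    refine hf.eventually (Units.isOpen.mem_nhds ?_)
    rw [hf1]
    exact isUnit_sub_of_mem_resolventSet h hz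
  -- Invertibility holds on both sides of `1`; the left side is chosen so that the weight decays.
  obtain ⟨q, hfq, hq0, hq1⟩ := ((hev.filter_mono nhdsWithin_le_nhds).and
    (Ioo_mem_nhdsLT (zero_lt_one' ℝ))).exists
  have hqC : (q : ℂ) ≠ 0 := by exact_mod_cast hq0.ne'
  set w : EllTwo D.Idx := Ring.inverse (f q) D.e with hw
  have hfw : f q w = D.e := congrArg (fun T => T D.e) (Ring.mul_inverse_cancel _ hfq)
  have hle : ∀ i : D.Idx, ‖(q : ℂ) ^ i.1 * w i‖ = q ^ i.1 * ‖w i‖ := fun i => by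
    rw [norm_mul, norm_pow, Complex.norm_real, Real.norm_eq_abs, abs_of_pos hq0]
  have hmem : Memℓp (fun i : D.Idx => (q : ℂ) ^ i.1 * w i) 2 := by
    refine memℓp_gen' (C := ‖w‖ ^ (2 : ENNReal).toReal) fun s => le_trans ?_
      (lp.sum_rpow_le_norm_rpow (p := 2) (by norm_num) w s)
    refine Finset.sum_le_sum fun i _ => Real.rpow_le_rpow (norm_nonneg _) ?_ (by norm_num)
    rw [hle]
    exact mul_le_of_le_one_left (norm_nonneg _) (pow_le_one₀ hq0.le hq1.le)
  let x : EllTwo D.Idx := ⟨fun i : D.Idx => (q : ℂ) ^ i.1 * w i, hmem⟩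
  have hx : A x = D.e := by
    ext i
    rw [hA, H_sub_apply h, matVec_Hmat h]
    change matVec D.diagMat (fun i : D.Idx => (q : ℂ) ^ i.1 * w i) i
      + matVec D.lowerMat (fun i : D.Idx => (q : ℂ) ^ i.1 * w i) i
      + matVec D.upperMat (fun i : D.Idx => (q : ℂ) ^ i.1 * w i) i
      - z * ((q : ℂ) ^ i.1 * w i) = D.e i
    rw [matVec_mul_eq (α := (q : ℂ) ^ i.1) fun j hj => by rw [diagMat_ne_zero hj],
      matVec_mul_eq (α := (q : ℂ) ^ i.1 * (q : ℂ)⁻¹) fun j hj => by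
        rw [(lowerMat_ne_zero hj).2.2, pow_succ]; field_simp,
      matVec_mul_eq (α := (q : ℂ) ^ i.1 * q) fun j hj => by
        rw [(upperMat_ne_zero hj).2.2, pow_succ]]
    have hi : matVec D.Hmat w i - z * w i + ((q : ℂ)⁻¹ - 1) * matVec D.lowerMat w i
        + ((q : ℂ) - 1) * matVec D.upperMat w i = D.e i := by
      rw [← hfw, ← H_sub_apply h]
      rfl
    rw [matVec_Hmat h] at hi
    -- The weight fixes `e`, which lives in block `0`.
    have he : (q : ℂ) ^ i.1 * D.e i = D.e i := by
      obtain ⟨j, r⟩ := i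
      cases j with
      | zero => simp
      | succ j => rw [e_apply_succ, mul_zero]
    rw [← he]
    linear_combination (q : ℂ) ^ i.1 * hi
  refine ⟨q, ‖w‖, hq0, hq1, norm_nonneg _, fun i => ?_⟩
  rw [← eq_resolventVec h hz hx]
  change ‖(q : ℂ) ^ i.1 * w i‖ ≤ _
  rw [hle, mul_comm]
  gcongr
  exact lp.norm_apply_le_norm (by norm_num) w i

/-! ### The polynomials of the first kind do not decay on the resolvent set -/

/-- Bounded degrees and coefficients bound all Horner tails by one constant `T`, so block `j`
contributes at most `N T² |P_j|²`. -/
lemma memℓp_formalEigenvector (h : D.Bounded) {z : ℂ}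
    (hP : Summable fun j => ‖aeval z (D.P j)‖ ^ 2) : Memℓp (formalEigenvector D z) 2 := by
  obtain ⟨N, hN⟩ := h.degrees
  obtain ⟨K, hK⟩ := h.coeffs
  -- The bound `K` does not cover the leading coefficient, hence the maximum with `1`.
  have hc : ∀ j r, |(D.p j).coeff r| ≤ max K 1 := fun j r => by
    rcases lt_trichotomy r (D.p j).natDegree with hr | hr | hr
    · exact ((hK j).2 r hr).trans (le_max_left _ _)
    · rw [hr, (D.monic j).coeff_natDegree, abs_one]
      exact le_max_right _ _
    · rw [coeff_eq_zero_of_natDegree_lt hr, abs_zero]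
      exact zero_le_one.trans (le_max_right _ _)
  set T : ℝ := (N + 1) * (max K 1 * (1 + ‖z‖) ^ N) with hT
  have hle : ∀ i : D.Idx, ‖formalEigenvector D z i‖ ^ 2 ≤ T ^ 2 * ‖aeval z (D.P i.1)‖ ^ 2 := by
    intro i
    rw [← mul_pow]
    refine pow_le_pow_left₀ (norm_nonneg _) ?_ 2
    rw [formalEigenvector, norm_mul, norm_mul, Complex.norm_real, Real.norm_eq_abs, D.abs_sign,
      one_mul, mul_comm]
    gcongr
    exact norm_tailEval_le (hN _) (hc _) z _
  refine memℓp_gen ?_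
  simp only [ENNReal.toReal_ofNat, Real.rpow_ofNat]
  rw [summable_sigma_of_nonneg (fun i => by positivity)]
  refine ⟨fun j => (hasSum_fintype _).summable, ?_⟩
  refine Summable.of_nonneg_of_le (fun j => tsum_nonneg fun r => by positivity) (fun j => ?_)
    (hP.mul_left (N * T ^ 2))
  rw [tsum_fintype]
  calc ∑ r, ‖formalEigenvector D z ⟨j, r⟩‖ ^ 2
      ≤ ∑ _r : Fin (D.p j).natDegree, T ^ 2 * ‖aeval z (D.P j)‖ ^ 2 :=
        Finset.sum_le_sum fun r _ => hle ⟨j, r⟩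
    _ = (D.p j).natDegree * (T ^ 2 * ‖aeval z (D.P j)‖ ^ 2) := by
        rw [Finset.sum_const, Finset.card_univ, Fintype.card_fin, nsmul_eq_mul]
    _ ≤ N * (T ^ 2 * ‖aeval z (D.P j)‖ ^ 2) := by
        gcongr
        exact hN j
    _ = N * T ^ 2 * ‖aeval z (D.P j)‖ ^ 2 := by ring

/-- Otherwise the formal eigenvector lies in `ℓ²` and in the kernel of the invertible `H - z`,
though its last entry in block `0` is `ε_0 ≠ 0`. -/
lemma not_summable_norm_P_sq (h : D.Bounded) {z : ℂ} (hz : z ∈ resolventSet ℂ (D.H h)) :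
    ¬ Summable fun j => ‖aeval z (D.P j)‖ ^ 2 := by
  intro hP
  let v : EllTwo D.Idx := ⟨formalEigenvector D z, memℓp_formalEigenvector h hP⟩
  have hv : (D.H h - algebraMap ℂ _ z) v = 0 := by
    ext i
    rw [H_sub_apply h]
    change matVec D.Hmat (formalEigenvector D z) i - z * formalEigenvector D z i = 0
    rw [matVec_formalEigenvector h, sub_self]
  have hv0 : v = 0 := by
    have := congrArg (fun T => T v)
      (Ring.inverse_mul_cancel _ (isUnit_sub_of_mem_resolventSet h hz))
    change Ring.inverse (D.H h - algebraMap ℂ _ z) ((D.H h - algebraMap ℂ _ z) v) = v at this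
    rw [← this, hv, map_zero]
  have h0 : formalEigenvector D z (D.last 0) = 0 := congrArg (fun u : EllTwo D.Idx => u _) hv0
  rw [formalEigenvector_last, aeval_P_zero, mul_one] at h0
  have := D.sign_mul_sign 0
  rw [h0] at this
  simp at this

lemma frequently_pow_lt_norm_P (h : D.Bounded) {z : ℂ} (hz : z ∈ resolventSet ℂ (D.H h)) {s : ℝ}
    (hs0 : 0 < s) (hs1 : s < 1) : ∃ᶠ j in Filter.atTop, s ^ j < ‖aeval z (D.P j)‖ := by
  intro hev
  refine not_summable_norm_P_sq h hz (Summable.of_norm_bounded_eventually_nat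
    (summable_geometric_of_lt_one (r := s ^ 2) (by positivity) (by nlinarith)) ?_)
  filter_upwards [hev] with j hj
  rw [norm_pow, norm_norm, ← pow_mul, mul_comm 2 j, pow_mul]
  exact pow_le_pow_left₀ (norm_nonneg _) (not_lt.1 hj) 2

lemma exists_geometric_subsequence (h : D.Bounded) {z : ℂ} (hz : z ∈ resolventSet ℂ (D.H h)) :
    ∃ ν : ℕ → ℕ, StrictMono ν ∧ (∀ i, 1 ≤ ν i) ∧ (∀ i, aeval z (D.P (ν i)) ≠ 0) ∧
      Filter.Tendsto (fun i => D.convergent (ν i) z) Filter.atTop (nhds (D.m h z)) ∧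
      ∃ c r : ℝ, 0 < c ∧ 0 < r ∧ r < 1 ∧
        ∀ i, ‖D.m h z - D.convergent (ν i) z‖ ≤ c * r ^ ν i := by
  obtain ⟨q, C, hq0, hq1, hC, hx⟩ := exists_norm_resolventVec_le h hz
  -- The midpoint of `q` and `1` leaves room on both sides: `|P_j|` exceeds `s ^ j` infinitely
  -- often, and the ratio `q / s` is below `1`.
  have hs0 : 0 < (q + 1) / 2 := by linarith
  have hs1 : (q + 1) / 2 < 1 := by linarith
  have hqs : q < (q + 1) / 2 := by linarith
  set s := (q + 1) / 2
  obtain ⟨ν, hν, hνP⟩ := Filter.extraction_of_frequently_atTop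
    ((frequently_pow_lt_norm_P h hz hs0 hs1).and_eventually (Filter.eventually_ge_atTop 1))
  have hP : ∀ i, aeval z (D.P (ν i)) ≠ 0 := fun i =>
    norm_pos_iff.1 ((by positivity : 0 < s ^ ν i).trans (hνP i).1)
  have hr0 : 0 < q / s := by positivity
  have hr1 : q / s < 1 := (div_lt_one hs0).2 hqs
  -- `C` may be zero; `C + 1` is a strictly positive constant.
  have hbound : ∀ i, ‖D.m h z - D.convergent (ν i) z‖ ≤ (C + 1) * (q / s) ^ ν i := fun i => by
    rw [norm_m_sub_convergent h hz (hP i), div_pow, ← mul_div_assoc]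
    refine div_le_div₀ (by positivity) ((hx _).trans ?_) (by positivity) (hνP i).1.le
    change C * q ^ ν i ≤ (C + 1) * q ^ ν i
    gcongr
    linarith
  refine ⟨ν, hν, fun i => (hνP i).2, hP, ?_, C + 1, q / s, by linarith, hr0, hr1, hbound⟩
  rw [tendsto_iff_norm_sub_tendsto_zero]
  refine squeeze_zero (fun i => norm_nonneg _)
    (fun i => (norm_sub_rev _ _).trans_le (hbound i)) ?_
  have := ((tendsto_pow_atTop_nhds_zero_of_lt_one hr0.le hr1).comp hν.tendsto_atTop).const_mul
    (C + 1)
  simpa using this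

end GenJacobi

namespace GenJacobi

variable {D : GenJacobi}

/-! ### Decay of the resolvent at infinity -/

/-- The position of a basis vector in the lexicographic enumeration. -/
def pos (i : D.Idx) : ℕ := D.n i.1 + i.2

lemma n_succ (D : GenJacobi) (j : ℕ) : D.n (j + 1) = D.n j + (D.p j).natDegree := by
  rw [n, Finset.sum_range_succ]
  rfl

/-- `H` is an upper Hessenberg matrix in the lexicographic order: the companion ones and the `b_j`
together fill the first subdiagonal, and nothing lies below it. -/
lemma pos_le_of_Hmat_ne_zero {x y : D.Idx} (hxy : D.Hmat x y ≠ 0) : pos x ≤ pos y + 1 := by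
  rw [Hmat_eq, Matrix.add_apply, Matrix.add_apply] at hxy
  by_cases h1 : D.lowerMat x y = 0
  · by_cases h2 : D.upperMat x y = 0
    · rw [h1, h2, add_zero, add_zero] at hxy
      have h3 := diagMat_ne_zero hxy
      obtain ⟨i, r⟩ := x
      obtain ⟨j, s⟩ := y
      simp only at h3
      subst h3
      rw [diagMat, Matrix.blockDiagonal'_apply_eq] at hxy
      simp only [companionMatrix, Matrix.of_apply] at hxy
      simp only [pos]
      have := r.2
      by_contra hlt
      rw [if_neg (by omega), if_neg (by omega)] at hxy
      exact hxy rfl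
    · obtain ⟨h3, h4, h5⟩ := upperMat_ne_zero h2
      simp only [pos, h3, h5, n_succ]
      omega
  · obtain ⟨h3, h4, h5⟩ := lowerMat_ne_zero h1
    simp only [pos, h3, h5, n_succ]
    omega

lemma e_apply_of_pos {i : D.Idx} (hi : 0 < pos i) : D.e i = 0 :=
  e_apply_ne fun h => by subst h; simp [pos, n] at hi

instance : Nontrivial (EllTwo D.Idx) := ⟨⟨D.e, 0, e_ne_zero D⟩⟩

lemma mem_resolventSet_of_norm_lt (h : D.Bounded) {z : ℂ} (hz : ‖D.H h‖ < ‖z‖) :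
    z ∈ resolventSet ℂ (D.H h) :=
  spectrum.mem_resolventSet_of_norm_lt hz

/-- Away from position `0` one has `z x_i = (H x)_i`, and row `i` sees only positions at least `pos
i - 1`; each step down thus gains a factor `K / |z|`. Since row `i` also reaches positions beyond
`i`, the induction is over all positions at least `s`. -/
lemma exists_norm_resolventVec_le_inv_pow (h : D.Bounded) :
    ∃ K R : ℝ, 0 ≤ K ∧ ∀ z : ℂ, R ≤ ‖z‖ → ∀ s (i : D.Idx), s ≤ pos i →
      ‖resolventVec h z i‖ ≤ 2 * ‖D.e‖ * K ^ s * (‖z‖ ^ (s + 1))⁻¹ := by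
  obtain ⟨K, hK, hM⟩ := (isBandBounded_Hmat h).exists_norm_matVec_le
  refine ⟨K, 2 * ‖D.H h‖ + 1, hK, fun z hz s => ?_⟩
  have hz0 : 0 < ‖z‖ := by linarith [norm_nonneg (D.H h)]
  have hzρ := mem_resolventSet_of_norm_lt h (by linarith [norm_nonneg (D.H h)] : ‖D.H h‖ < ‖z‖)
  induction s with
  | zero =>
    intro i _
    have h1 : z • resolventVec h z = D.H h (resolventVec h z) - D.e := by
      rw [← H_sub_resolventVec h hzρ, Algebra.algebraMap_eq_smul_one]
      change _ = D.H h (resolventVec h z) - (D.H h (resolventVec h z) - z • resolventVec h z)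
      rw [sub_sub_cancel]
    have h2 : ‖z‖ * ‖resolventVec h z‖ ≤ ‖D.H h‖ * ‖resolventVec h z‖ + ‖D.e‖ := by
      rw [← norm_smul, h1]
      exact (norm_sub_le _ _).trans (add_le_add_left ((D.H h).le_opNorm _) _)
    -- Uses `|z| - ‖H‖ ≥ |z| / 2`, which is why `R` is taken above `2 ‖H‖`.
    have h3 : ‖resolventVec h z‖ * ‖z‖ ≤ 2 * ‖D.e‖ := by
      nlinarith [norm_nonneg (resolventVec h z), norm_nonneg (D.H h)]
    rw [zero_add, pow_zero, mul_one, pow_one, ← div_eq_mul_inv, le_div_iff₀ hz0]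
    refine le_trans ?_ h3
    gcongr
    exact lp.norm_apply_le_norm (by norm_num) _ i
  | succ s ih =>
    intro i hi
    have h1 := matVec_resolventVec h hzρ i
    rw [e_apply_of_pos (by omega), sub_eq_zero] at h1
    have h2 := hM (resolventVec h z) i _ (by positivity) fun j hj =>
      ih j (by have := pos_le_of_Hmat_ne_zero hj; omega)
    rw [h1, norm_mul] at h2
    rw [pow_succ ‖z‖ (s + 1), mul_inv, ← mul_assoc, ← div_eq_mul_inv _ ‖z‖, le_div_iff₀ hz0]
    refine le_trans (by rw [mul_comm]) (h2.trans_eq ?_)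
    ring

/-! ### Degrees of the polynomials of the first and second kind -/

/-- The term with `P_j` has degree `n_j < n_{j+2}` and cannot cancel the leading term. The exact
degree is what makes `B(0) ≠ 0`. -/
lemma degree_P (D : GenJacobi) (j : ℕ) : (D.P j).degree = D.n j := by
  induction j using Nat.twoStepInduction with
  | zero => simp [P, recSol, n]
  | one =>
    have hb : (D.b 0)⁻¹ ≠ 0 := inv_ne_zero (D.b_pos 0).ne'
    simp only [P, recSol]
    rw [degree_mul, degree_C hb, zero_add, degree_eq_natDegree (D.monic 0).ne_zero, n_succ]
    simp [n]
  | more j ih0 ih1 =>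
    have hb : (D.b (j + 1))⁻¹ ≠ 0 := inv_ne_zero (D.b_pos _).ne'
    have h1 : (D.p (j + 1) * D.P (j + 1)).degree = D.n (j + 2) := by
      rw [degree_mul, ih1, degree_eq_natDegree (D.monic _).ne_zero, n_succ D (j + 1), add_comm]
      push_cast
      rfl
    change (C (D.b (j + 1))⁻¹ * (D.p (j + 1) * D.P (j + 1)
      - C (D.ε j * D.ε (j + 1) * D.b j) * D.P j)).degree = _
    rw [degree_mul, degree_C hb, zero_add, degree_sub_eq_left_of_degree_lt, h1]
    rw [h1]
    rw [C_mul']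
    refine (degree_smul_le _ _).trans_lt ?_
    rw [ih0, n_succ, n_succ]
    have := D.deg_pos j
    exact_mod_cast (by omega : D.n j < D.n j + (D.p j).natDegree + (D.p (j + 1)).natDegree)

lemma natDegree_Q_le (D : GenJacobi) (j : ℕ) : (D.Q j).natDegree ≤ D.n j := by
  induction j using Nat.twoStepInduction with
  | zero => simp [Q, recSol]
  | one => simp [Q, recSol]
  | more j ih0 ih1 =>
    change (C (D.b (j + 1))⁻¹ * (D.p (j + 1) * D.Q (j + 1)
      - C (D.ε j * D.ε (j + 1) * D.b j) * D.Q j)).natDegree ≤ _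
    refine (natDegree_C_mul_le _ _).trans ((natDegree_sub_le _ _).trans (max_le ?_ ?_))
    · refine natDegree_mul_le.trans ?_
      rw [n_succ D (j + 1)]
      omega
    · refine (natDegree_C_mul_le _ _).trans (ih0.trans ?_)
      rw [n_succ, n_succ]
      omega

end GenJacobi

/-! ### Reversed polynomials -/

/-- The polynomial `t ↦ t ^ N q(1 / t)` with complex coefficients. -/
def complexReflect (N : ℕ) (q : ℝ[X]) : ℂ[X] := reflect N (q.map (algebraMap ℝ ℂ))

lemma natDegree_complexReflect_le {N : ℕ} {q : ℝ[X]} (hq : q.natDegree ≤ N) :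
    (complexReflect N q).natDegree ≤ N := by
  refine natDegree_reflect_le.trans (max_le le_rfl ?_)
  rwa [natDegree_map]

lemma eval_complexReflect {N : ℕ} {q : ℝ[X]} (hq : q.natDegree ≤ N) {z : ℂ} (hz : z ≠ 0) :
    aeval z q = z ^ N * (complexReflect N q).eval z⁻¹ := by
  let _ := invertibleOfNonzero hz
  have := eval₂_reflect_mul_pow (RingHom.id ℂ) z N (q.map (algebraMap ℝ ℂ))
    (by rwa [natDegree_map])
  rw [invOf_eq_inv, eval₂_id, eval₂_id, eval_map_algebraMap] at this
  rw [← this, complexReflect, mul_comm]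

lemma eval_zero_complexReflect (N : ℕ) (q : ℝ[X]) :
    (complexReflect N q).eval 0 = q.coeff N := by
  rw [← coeff_zero_eq_eval_zero, complexReflect, coeff_reflect, revAt_zero, coeff_map]
  rfl

/-! ### The Padé property at infinity -/

namespace GenJacobi

variable {D : GenJacobi}

/-- `A` and `B` are `-Q_j` and `P_j` reversed in degree `n_j`, so `B(0)` is the leading coefficient
of `P_j`. For large `z` this gives `|P_j| ≥ |z| ^ n_j |B(0)| / 2`, against a numerator of order
`z^{-(n_j + 1)}`. -/
lemma isPadeApproximant_convergent (h : D.Bounded) (j : ℕ) :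
    IsPadeApproximant (D.m h) (D.n j) (D.n j) (D.convergent j) := by
  have hPd : (D.P j).natDegree = D.n j := natDegree_eq_of_degree_eq_some (degree_P D j)
  have hB0 : (complexReflect (D.n j) (D.P j)).eval 0 ≠ 0 := by
    rw [eval_zero_complexReflect, ← hPd, coeff_natDegree]
    have : D.P j ≠ 0 := fun h0 => by
      have := degree_P D j
      simp [h0] at this
    exact_mod_cast leadingCoeff_ne_zero.2 this
  refine ⟨-complexReflect (D.n j) (D.Q j), complexReflect (D.n j) (D.P j), ?_,
    natDegree_complexReflect_le hPd.le, hB0, fun z hz => ?_, ?_⟩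
  · rw [natDegree_neg]
    exact natDegree_complexReflect_le (natDegree_Q_le D j)
  -- Only the power of `z` is cancelled, so the identity also holds at zeros of `P_j`, where both
  -- quotients are `0` by convention.
  · rw [convergent, eval_complexReflect hPd.le hz, eval_complexReflect (natDegree_Q_le D j) hz,
      eval_neg, ← mul_neg, mul_div_mul_left _ _ (pow_ne_zero _ hz)]
  · set B := complexReflect (D.n j) (D.P j) with hB
    obtain ⟨K, R, hK, hx⟩ := exists_norm_resolventVec_le_inv_pow h
    have hlim : Filter.Tendsto (fun z : ℂ => ‖B.eval z⁻¹‖) (Bornology.cobounded ℂ)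
        (nhds ‖B.eval 0‖) :=
      ((B.continuous.tendsto 0).comp Filter.tendsto_inv₀_cobounded).norm
    have hβ : 0 < ‖B.eval 0‖ := norm_pos_iff.2 hB0
    have hnorm := tendsto_norm_cobounded_atTop (E := ℂ)
    refine Asymptotics.IsBigO.of_bound (2 * ‖D.e‖ * K ^ D.n j / (‖B.eval 0‖ / 2)) ?_
    filter_upwards [hlim.eventually (lt_mem_nhds (half_lt_self hβ)),
      hnorm.eventually (Filter.eventually_ge_atTop R),
      hnorm.eventually (Filter.eventually_gt_atTop ‖D.H h‖)] with z hzB hzR hzH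
    have hz0 : z ≠ 0 := norm_pos_iff.1 ((norm_nonneg _).trans_lt hzH)
    have hPz : aeval z (D.P j) = z ^ D.n j * B.eval z⁻¹ := eval_complexReflect hPd.le hz0
    have hBz : B.eval z⁻¹ ≠ 0 := norm_pos_iff.1 ((half_pos hβ).trans hzB)
    have hP0 : aeval z (D.P j) ≠ 0 := by
      rw [hPz]
      exact mul_ne_zero (pow_ne_zero _ hz0) hBz
    rw [norm_m_sub_convergent h (mem_resolventSet_of_norm_lt h hzH) hP0, hPz, norm_mul, norm_pow,
      norm_inv, norm_pow]
    have hzn : 0 < ‖z‖ := norm_pos_iff.2 hz0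
    calc ‖resolventVec h z (D.last j)‖ / (‖z‖ ^ D.n j * ‖B.eval z⁻¹‖)
        ≤ (2 * ‖D.e‖ * K ^ D.n j * (‖z‖ ^ (D.n j + 1))⁻¹) / (‖z‖ ^ D.n j * (‖B.eval 0‖ / 2)) := by
          -- The last vector of block `j` has position `n_j + k_j - 1`; only that this is at least
          -- `n_j` is used.
          refine div_le_div₀ (by positivity) (hx z hzR _ _ (Nat.le_add_right _ _))
            (by positivity) ?_
          gcongr
      _ = 2 * ‖D.e‖ * K ^ D.n j / (‖B.eval 0‖ / 2) * (‖z‖ ^ (D.n j + D.n j + 1))⁻¹ := by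
          field_simp
          ring

end GenJacobi

end

theorem theorem7p5 (D : GenJacobi) (h : D.Bounded) :
    (∀ j : ℕ, 1 ≤ j → IsPadeApproximant (D.m h) (D.n j) (D.n j) (D.convergent j)) ∧
    ∀ z ∈ resolventSet ℂ (D.H h),
      ∃ ν : ℕ → ℕ, StrictMono ν ∧ (∀ i, 1 ≤ ν i) ∧
        (∀ i, Polynomial.aeval z (D.P (ν i)) ≠ 0) ∧
        Filter.Tendsto (fun i => D.convergent (ν i) z) Filter.atTop (nhds (D.m h z)) ∧
        ∃ c r : ℝ, 0 < c ∧ 0 < r ∧ r < 1 ∧ ∀ i, ‖D.m h z - D.convergent (ν i) z‖ ≤ c * r ^ ν i :=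
  ⟨fun j _ => GenJacobi.isPadeApproximant_convergent h j,
    fun _ hz => GenJacobi.exists_geometric_subsequence h hz⟩
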